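/- Black-box model. A Hermitian $D\times D$ matrix $H$ is $d$-sparse if every row and every column has at most $d$ nonzero entries; $\|H\|_{\max}$ is the largest absolute value of an entry. A black box for a $d$-sparse $H$ accepts a row index $v$ and a number $k\in\{1,\dots,d\}$ and returns the position and value of the $k$-th nonzero entry of row $v$ (in increasing column order; a special symbol if there is none); the answer, encoded as a $b$-bit string by a fixed encoding, is XORed into an answer register. A $T$-query algorithm is a circuit $U_T\,O_H\,U_{T-1}\cdots O_H\,U_0$ on a system register of dimension $D$, the query registers and a finite workspace, where the unitaries $U_i$ do not depend on $H$ and $O_H$ is the black box applied to the query registers. It simulates $H$ for time $t$ with precision $\epsilon$ if, with the registers other than the system starting in a fixed basis state, it maps every state $|\psi\rangle$ of the system to a state within Euclidean distance $\epsilon$ of $(e^{-iHt}|\psi\rangle)\otimes|\varphi\rangle$ for some state $|\varphi\rangle$ of the other registers. For $x\in\{0,1\}^N$ let $H_x$ be the matrix with rows and columns indexed by $|i,j\rangle$, $0\le i\le N$, $j\in\{0,1\}$ (ordered by $2i+j$), whose nonzero entries are $$\langle i,j|H_x|i-1,j\oplus x_i\rangle=\langle i-1,j\oplus x_i|H_x|i,j\rangle=\frac{\sqrt{(N-i+1)\,i}}{N},\qquad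 1\le i\le N,\ j\in\{0,1\}.$$ Theorem ($\epsilon$-dependent lower bound for Hamiltonian simulation). There is a constant $c>0$ such that for every time $t>0$ there is an $\epsilon_0>0$ with the following property. For every $0<\epsilon<\epsilon_0$ there is an $N\ge 2$, with $N+1=2^n$ a power of two (so that the $H_x$ act on $n+1$ qubits), such that (1) for every $x\in\{0,1\}^N$, $H_x$ is Hermitian and 2-sparse with $\|H_x\|_{\max}<1$, and, with $p=x_1\oplus\cdots\oplus x_N$, for every real $s$ one has $|\langle N,p|e^{-iH_xs}|0,0\rangle|=|\sin(s/N)|^N$ and $\langle N,1\oplus p|e^{-iH_xs}|0,0\rangle=0$; (2) for every $b$ and every $b$-bit encoding of the answers of the black box, every query algorithm that, given the black box for $H_x$, simulates $H_x$ for time $t$ with precision $\epsilon$, for every $x\in\{0,1\}^N$, makes at least $$c\,\frac{\log(1/\epsilon)}{\log\log(1/\epsilon)}$$ queries. -/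

import Mathlib

open scoped Matrix

noncomputable section

namespace HamSim

/-- `H` has at most `d` nonzero entries in any row or column. -/
def IsSparse {D : ℕ} (d : ℕ) (H : Matrix (Fin D) (Fin D) ℂ) : Prop :=
  (∀ i, {j | H i j ≠ 0}.ncard ≤ d) ∧ ∀ j, {i | H i j ≠ 0}.ncard ≤ d

/-- The largest absolute value of an entry. -/
def maxNorm {D : ℕ} (H : Matrix (Fin D) (Fin D) ℂ) : ℝ :=
  ⨆ p : Fin D × Fin D, ‖H p.1 p.2‖

/-- The time evolution `e^{-iHt}`. -/
def evolution {D : ℕ} (H : Matrix (Fin D) (Fin D) ℂ) (t : ℝ) : Matrix (Fin D) (Fin D) ℂ :=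
  NormedSpace.exp ((-(Complex.I * (t : ℂ))) • H)

/-! ### Black-box access to a sparse Hamiltonian -/

open Classical in
/-- The position and the value of the `k`-th nonzero entry of `H` in row `v` (columns in increasing
order, `k` counted from `0`), or `none` if the row has at most `k` nonzero entries. -/
def sparseEntry {D d : ℕ} (H : Matrix (Fin D) (Fin D) ℂ) (v : Fin D) (k : Fin d) :
    Option (Fin D × ℂ) :=
  ((Finset.univ.filter fun u => H v u ≠ 0).sort (· ≤ ·))[(k : ℕ)]?.map fun u => (u, H v u)

/-- Basis labels of the query registers: a row index, the number of an entry, and a `b`-bit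
register for the answer. -/
abbrev QueryReg (D d b : ℕ) : Type := Fin D × Fin d × (Fin b → Bool)

/-- Basis labels of all registers of an algorithm: the `D`-dimensional system, the query registers,
and a workspace of dimension `w`. -/
abbrev Registers (D d b w : ℕ) : Type := Fin D × QueryReg D d b × Fin w

/-- The action of the black box on basis states of the query registers: the answer, written as a
`b`-bit string by `enc`, is XORed into the answer register. -/
def queryMap {D d b : ℕ} (enc : Option (Fin D × ℂ) → Fin b → Bool)
    (H : Matrix (Fin D) (Fin D) ℂ) (q : QueryReg D d b) : QueryReg D d b :=
  (q.1, q.2.1, fun r => xor (q.2.2 r) (enc (sparseEntry H q.1 q.2.1) r))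

/-- The query gate: the black box on the query registers, the identity on the other registers. -/
def queryGate {D d b : ℕ} (enc : Option (Fin D × ℂ) → Fin b → Bool)
    (H : Matrix (Fin D) (Fin D) ℂ) (w : ℕ) :
    Matrix (Registers D d b w) (Registers D d b w) ℂ :=
  Matrix.of fun p q => if p = (q.1, queryMap enc H q.2.1, q.2.2) then 1 else 0

/-- A quantum query algorithm with black-box access to `d`-sparse `D`-dimensional Hamiltonians.
The gates do not depend on the Hamiltonian; only `gate 0, …, gate queries` are used. -/
structure QueryAlgorithm (D d b : ℕ) where
  /-- dimension of the workspace -/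
  work : ℕ
  /-- basis state in which the query registers and the workspace start -/
  init : QueryReg D d b × Fin work
  /-- number of queries -/
  queries : ℕ
  /-- the unitaries between the queries -/
  gate : ℕ → Matrix.unitaryGroup (Registers D d b work) ℂ

/-- The circuit `U_k O U_{k-1} O ⋯ O U_0`, with `k` uses of the query gate `O`. -/
def QueryAlgorithm.partialCircuit {D d b : ℕ} (A : QueryAlgorithm D d b)
    (enc : Option (Fin D × ℂ) → Fin b → Bool) (H : Matrix (Fin D) (Fin D) ℂ) :
    ℕ → Matrix (Registers D d b A.work) (Registers D d b A.work) ℂ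
  | 0 => (A.gate 0).1
  | k + 1 => (A.gate (k + 1)).1 * queryGate enc H A.work * A.partialCircuit enc H k

/-- The unitary that the algorithm performs when its black box is the one of `H`. -/
def QueryAlgorithm.circuit {D d b : ℕ} (A : QueryAlgorithm D d b)
    (enc : Option (Fin D × ℂ) → Fin b → Bool) (H : Matrix (Fin D) (Fin D) ℂ) :
    Matrix (Registers D d b A.work) (Registers D d b A.work) ℂ :=
  A.partialCircuit enc H A.queries

/-- The Euclidean norm of a state vector. -/
def stateNorm {X : Type} [Fintype X] (f : X → ℂ) : ℝ :=
  ‖(WithLp.toLp 2 f : EuclideanSpace ℂ X)‖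

/-- The product state `|ψ⟩|φ⟩`. -/
def tensor {X Y : Type} (ψ : X → ℂ) (φ : Y → ℂ) : X × Y → ℂ :=
  fun p => ψ p.1 * φ p.2

/-- Given the black box for `H`, the algorithm performs `e^{-iHt}` on the system register with
error at most `ε`: for every input state `ψ` the output is within `ε` of `(e^{-iHt}ψ) ⊗ φ` for some
state `φ` of the other registers. These need not be returned to their initial state, so this also
admits every algorithm that does return them. -/
def QueryAlgorithm.Simulates {D d b : ℕ} (A : QueryAlgorithm D d b)
    (enc : Option (Fin D × ℂ) → Fin b → Bool) (H : Matrix (Fin D) (Fin D) ℂ) (t ε : ℝ) : Prop :=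
  ∀ ψ : Fin D → ℂ, stateNorm ψ = 1 →
    ∃ φ : QueryReg D d b × Fin A.work → ℂ, stateNorm φ = 1 ∧
      stateNorm (A.circuit enc H *ᵥ tensor ψ (Pi.single A.init 1)
        - tensor (evolution H t *ᵥ ψ) φ) ≤ ε

/-! ### The weighted path that encodes the parity of a bit string -/

/-- The basis state `|i, j⟩`, `0 ≤ i ≤ N`, `j ∈ {0, 1}`, numbered as `2 i + j`. -/
def vertex {N : ℕ} (i : Fin (N + 1)) (j : Fin 2) : Fin ((N + 1) * 2) :=
  finProdFinEquiv (i, j)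

/-- The Hamiltonian of `x ∈ {0,1}^N`: for `0 ≤ i < N` and `j ∈ {0, 1}`, the entries between
`|i + 1, j⟩` and `|i, j ⊕ x_{i+1}⟩` are `√((N - i)(i + 1)) / N`, and all others vanish. The bits
are indexed from `0`, so that `x i` is the bit `x_{i+1}`; addition in `Fin 2` is XOR. -/
def pathHamiltonian {N : ℕ} (x : Fin N → Fin 2) :
    Matrix (Fin ((N + 1) * 2)) (Fin ((N + 1) * 2)) ℂ :=
  ∑ i : Fin N, ∑ j : Fin 2,
    (((Real.sqrt (((N : ℝ) - (i : ℕ)) * ((i : ℕ) + 1)) / N : ℝ) : ℂ)) •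
      (Matrix.single (vertex i.succ j) (vertex i.castSucc (j + x i)) 1 +
        Matrix.single (vertex i.castSucc (j + x i)) (vertex i.succ j) 1)

/-- The parity `x_1 ⊕ ⋯ ⊕ x_N`. -/
def parity {N : ℕ} (x : Fin N → Fin 2) : Fin 2 := ∑ i, x i

end HamSim

end

open scoped Matrix

noncomputable section

namespace HamSim

/-! The proof is the polynomial method for parity with unbounded error. Starting from `|0, 0⟩`, the
evolution under `H_x` stays on the single path through the vertices `|i, x_1 ⊕ ⋯ ⊕ x_i⟩`, where it
is a spin rotation: the amplitude at the far end is `(-i sin (s / N)) ^ N`, and it sits on the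
vertex labelled by the parity. If `2 ε < |sin (t / N)| ^ N`, a simulation with error `ε` therefore
finds the end with the correct parity strictly more often than the other end, for every `x`. How
small this advantage is does not matter.

On the other hand, each row of `H_x` depends on at most two bits, so after `T` queries the
amplitudes have degree at most `2 T` in the bits and the probabilities at most `4 T`. Functions of
degree below `N` are orthogonal to parity, which excludes a positive advantage on every `x`; hence
`N ≤ 4 T` (`le_four_mul_queries`).

The closed form of the evolution comes from checking the Schrödinger equation
(`hasDerivAt_pathState`) and uniqueness (`evolution_mul_eq`). Since `|sin (t / N)| ^ N` decays like
`exp (-N log N)` up to a factor `exp (O(N))`, an `N` of order `log (1 / ε) / log log (1 / ε)` is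
admissible (`exists_path_length`). -/

/-! ### Functions of bit strings of bounded degree -/

/-- The linear combinations of functions that depend on at most `k` of the `N` bits. -/
def lowDegree (N k : ℕ) : Submodule ℂ ((Fin N → Fin 2) → ℂ) :=
  Submodule.span ℂ {f | ∃ S : Finset (Fin N), S.card ≤ k ∧ DependsOn f (S : Set (Fin N))}

theorem mem_lowDegree_of_dependsOn {N k : ℕ} {f : (Fin N → Fin 2) → ℂ} {S : Finset (Fin N)}
    (hS : S.card ≤ k) (hf : DependsOn f (S : Set (Fin N))) : f ∈ lowDegree N k :=
  Submodule.subset_span ⟨S, hS, hf⟩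

theorem const_mem_lowDegree (N k : ℕ) (c : ℂ) : (fun _ => c) ∈ lowDegree N k :=
  mem_lowDegree_of_dependsOn (S := ∅) (by simp) fun _ _ _ => rfl

/-- A product of two generators depends only on the union of their supports; bilinearity does the
rest. -/
theorem mul_mem_lowDegree {N k l : ℕ} {f g : (Fin N → Fin 2) → ℂ}
    (hf : f ∈ lowDegree N k) (hg : g ∈ lowDegree N l) :
    (fun x => f x * g x) ∈ lowDegree N (k + l) := by
  have h := Submodule.mul_mem_mul hf hg
  rw [lowDegree, lowDegree, Submodule.span_mul_span] at h
  refine Submodule.span_mono ?_ h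
  rintro _ ⟨f, ⟨S, hS, hf⟩, g, ⟨T, hT, hg⟩, rfl⟩
  refine ⟨S ∪ T, (Finset.card_union_le S T).trans (add_le_add hS hT), fun x y hxy => ?_⟩
  simp only [Finset.coe_union, Set.mem_union] at hxy
  simp only [Pi.mul_apply]
  rw [hf fun i hi => hxy i (Or.inl hi), hg fun i hi => hxy i (Or.inr hi)]

theorem star_mem_lowDegree {N k : ℕ} {f : (Fin N → Fin 2) → ℂ} (hf : f ∈ lowDegree N k) :
    (fun x => star (f x)) ∈ lowDegree N k := by
  induction hf using Submodule.span_induction with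
  | mem f hf =>
    obtain ⟨S, hS, hf⟩ := hf
    exact mem_lowDegree_of_dependsOn hS fun x y hxy => congrArg star (hf hxy)
  | zero => simpa using const_mem_lowDegree N k 0
  | add f g _ _ hf hg => simpa [Pi.add_def] using add_mem hf hg
  | smul c f _ hf =>
    simpa [mul_comm, Pi.smul_def] using (lowDegree N k).smul_mem (star c) hf

theorem fin_two_add_self (a : Fin 2) : a + a = 0 := by
  fin_cases a <;> rfl

theorem parity_update {N : ℕ} (x : Fin N → Fin 2) (i : Fin N) :
    parity (Function.update x i (1 + x i)) = 1 + parity x := by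
  have h : Function.update x i (1 + x i) = Pi.single i 1 + x := by
    ext j : 1
    by_cases hj : j = i
    · subst hj; simp
    · simp [hj]
  rw [parity, h]
  simp [parity, Finset.sum_add_distrib]

theorem neg_one_pow_one_add (a : Fin 2) : (-1 : ℂ) ^ ((1 + a : Fin 2) : ℕ) = -(-1) ^ (a : ℕ) := by
  fin_cases a <;> simp

/-- Functions of degree less than `N` are orthogonal to the parity of `N` bits. -/
theorem sum_neg_one_pow_parity_mul_eq_zero {N k : ℕ} (hk : k < N) {f : (Fin N → Fin 2) → ℂ}
    (hf : f ∈ lowDegree N k) : ∑ x, (-1 : ℂ) ^ (parity x : ℕ) * f x = 0 := by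
  induction hf using Submodule.span_induction with
  | mem f hf =>
    obtain ⟨S, hS, hf⟩ := hf
    obtain ⟨i, hi⟩ : ∃ i, i ∉ S := by
      by_contra! h
      have := Finset.card_le_card (fun i _ => h i : Finset.univ ⊆ S)
      simp at this
      omega
    have hne : ∀ a : Fin 2, 1 + a ≠ a := by decide
    -- Flipping a bit that `f` ignores reverses the sign of the parity character, so the terms
    -- cancel in pairs.
    refine Finset.sum_involution (fun x _ => Function.update x i (1 + x i)) ?_ ?_ ?_ ?_
    · intro x _
      have : f (Function.update x i (1 + x i)) = f x := hf fun j hj => by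
        rw [Function.update_of_ne]
        rintro rfl
        exact hi hj
      rw [this, parity_update, neg_one_pow_one_add]
      ring
    · intro x _ _ h
      exact hne (x i) (by simpa using congrFun h i)
    · simp
    · intro x _
      simp [← add_assoc, fin_two_add_self]
  | zero => simp
  | add f g _ _ hf hg => simp [mul_add, Finset.sum_add_distrib, hf, hg]
  | smul c f _ hf =>
    simp only [Pi.smul_apply, smul_eq_mul, mul_left_comm _ c, ← Finset.mul_sum, hf, mul_zero]

/-! ### Entries of the path Hamiltonian -/

/-- The weight of the edges between `|i⟩` and `|i + 1⟩`. -/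
def edgeWeight (N i : ℕ) : ℝ :=
  Real.sqrt (((N : ℝ) - i) * (i + 1)) / N

theorem pathHamiltonian_eq_sum {N : ℕ} (x : Fin N → Fin 2) :
    pathHamiltonian x = ∑ i : Fin N, ∑ j : Fin 2, (edgeWeight N i : ℂ) •
      (Matrix.single (vertex i.succ j) (vertex i.castSucc (j + x i)) 1 +
        Matrix.single (vertex i.castSucc (j + x i)) (vertex i.succ j) 1) :=
  rfl

theorem vertex_inj {N : ℕ} {i i' : Fin (N + 1)} {j j' : Fin 2} :
    vertex i j = vertex i' j' ↔ i = i' ∧ j = j' := by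
  simp [vertex]

theorem exists_eq_vertex {N : ℕ} (v : Fin ((N + 1) * 2)) : ∃ i j, v = vertex i j :=
  ⟨(finProdFinEquiv.symm v).1, (finProdFinEquiv.symm v).2,
    (finProdFinEquiv.apply_symm_apply v).symm⟩

theorem isHermitian_pathHamiltonian {N : ℕ} (x : Fin N → Fin 2) :
    (pathHamiltonian x).IsHermitian := by
  rw [Matrix.IsHermitian, pathHamiltonian_eq_sum]
  simp [Matrix.conjTranspose_sum, add_comm]

theorem pathHamiltonian_apply {N : ℕ} (x : Fin N → Fin 2) (a a' : Fin (N + 1)) (c c' : Fin 2) :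
    pathHamiltonian x (vertex a c) (vertex a' c') =
      ∑ i : Fin N, ((if a = i.succ ∧ a' = i.castSucc ∧ c' = c + x i
          then (edgeWeight N i : ℂ) else 0) +
        if a = i.castSucc ∧ a' = i.succ ∧ c' = c + x i then (edgeWeight N i : ℂ) else 0) := by
  rw [pathHamiltonian_eq_sum, Matrix.sum_apply]
  refine Finset.sum_congr rfl fun i _ => ?_
  have key : ∀ p q r : Fin 2, (p = q + r ↔ q = p + r) := by decide
  rw [Matrix.sum_apply]
  simp only [Matrix.smul_apply, Matrix.add_apply, Matrix.single_apply, vertex_inj, smul_eq_mul,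
    mul_add, Finset.sum_add_distrib, mul_ite, mul_one, mul_zero]
  congr 1
  · rw [Finset.sum_eq_single c]
    · simp only [eq_comm, and_true]
    · intro j _ hj; simp [hj]
    · simp
  · rw [Finset.sum_eq_single c']
    · congr 1
      have := key c' c (x i)
      simp only [eq_iff_iff]
      constructor
      · rintro ⟨⟨h1, h2⟩, h3, -⟩; exact ⟨h1.symm, h3.symm, this.2 h2.symm⟩
      · rintro ⟨h1, h2, h3⟩; exact ⟨⟨h1.symm, (this.1 h3).symm⟩, h2.symm, trivial⟩
    · intro j _ hj; simp [hj]
    · simp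

/-- Two neighbouring positions determine their edge, so at most one term of the sum survives. XOR is
its own inverse, so the condition on the bits is the same in both directions. -/
theorem pathHamiltonian_apply_eq_zero_or {N : ℕ} (x : Fin N → Fin 2) (a a' : Fin (N + 1))
    (c c' : Fin 2) :
    pathHamiltonian x (vertex a c) (vertex a' c') = 0 ∨
      ∃ i : Fin N, pathHamiltonian x (vertex a c) (vertex a' c') = edgeWeight N i ∧
        c' = c + x i ∧ ((a = i.succ ∧ a' = i.castSucc) ∨ (a = i.castSucc ∧ a' = i.succ)) := by
  by_cases h : ∃ i : Fin N, c' = c + x i ∧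
      ((a = i.succ ∧ a' = i.castSucc) ∨ (a = i.castSucc ∧ a' = i.succ))
  · obtain ⟨i, hc, h⟩ := h
    refine Or.inr ⟨i, ?_, hc, h⟩
    rw [pathHamiltonian_apply, Finset.sum_eq_single i]
    · rcases h with ⟨rfl, rfl⟩ | ⟨rfl, rfl⟩
      · have : i.succ ≠ i.castSucc := by simp [Fin.ext_iff]
        simp [hc, this]
      · have : i.castSucc ≠ i.succ := by simp [Fin.ext_iff]
        simp [hc, this]
    · intro k _ hk
      have hk' : (k : ℕ) ≠ i := fun e => hk (Fin.ext e)
      rcases h with ⟨rfl, rfl⟩ | ⟨rfl, rfl⟩ <;>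
      · simp only [Fin.ext_iff, Fin.val_succ, Fin.val_castSucc]
        rw [if_neg (by omega), if_neg (by omega), add_zero]
    · simp
  · left
    push Not at h
    rw [pathHamiltonian_apply]
    refine Finset.sum_eq_zero fun i _ => ?_
    have := h i
    rw [if_neg (by tauto), if_neg (by tauto), add_zero]

theorem edgeWeight_nonneg (N i : ℕ) : 0 ≤ edgeWeight N i := by
  unfold edgeWeight; positivity

/-- By AM-GM the radicand is at most `((N + 1) / 2) ^ 2`, which is below `N ^ 2` once `N > 1`. -/
theorem edgeWeight_lt_one {N i : ℕ} (hN : 2 ≤ N) : edgeWeight N i < 1 := by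
  have h2 : (2 : ℝ) ≤ N := by exact_mod_cast hN
  rw [edgeWeight, div_lt_one (by linarith), Real.sqrt_lt' (by linarith)]
  nlinarith [sq_nonneg ((N : ℝ) - i - (i + 1))]

theorem maxNorm_pathHamiltonian_lt_one {N : ℕ} (hN : 2 ≤ N) (x : Fin N → Fin 2) :
    maxNorm (pathHamiltonian x) < 1 := by
  have : Nonempty (Fin ((N + 1) * 2) × Fin ((N + 1) * 2)) := ⟨(vertex 0 0, vertex 0 0)⟩
  obtain ⟨⟨v, u⟩, h⟩ := exists_eq_ciSup_of_finite
    (f := fun p : Fin ((N + 1) * 2) × Fin ((N + 1) * 2) => ‖pathHamiltonian x p.1 p.2‖)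
  rw [maxNorm, ← h]
  obtain ⟨a, c, rfl⟩ := exists_eq_vertex v
  obtain ⟨a', c', rfl⟩ := exists_eq_vertex u
  rcases pathHamiltonian_apply_eq_zero_or x a a' c c' with h | ⟨i, h, -⟩
  · simp [h]
  · simpa [h, abs_of_nonneg (edgeWeight_nonneg N i)] using edgeWeight_lt_one hN

theorem isSparse_pathHamiltonian {N : ℕ} (x : Fin N → Fin 2) :
    IsSparse 2 (pathHamiltonian x) := by
  have row : ∀ v, {u | pathHamiltonian x v u ≠ 0}.ncard ≤ 2 := by
    intro v
    obtain ⟨a, c, rfl⟩ := exists_eq_vertex v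
    -- At an end of the path one neighbour is missing. The default `vertex 0 0` only enlarges the
    -- covering set, which still has at most two elements.
    let below : Fin ((N + 1) * 2) := Fin.cases (motive := fun _ => Fin ((N + 1) * 2))
      (vertex 0 0) (fun i => vertex i.castSucc (c + x i)) a
    let above : Fin ((N + 1) * 2) := Fin.lastCases (motive := fun _ => Fin ((N + 1) * 2))
      (vertex 0 0) (fun i => vertex i.succ (c + x i)) a
    have hsub : {u | pathHamiltonian x (vertex a c) u ≠ 0} ⊆ {below, above} := by
      intro u hu
      obtain ⟨a', c', rfl⟩ := exists_eq_vertex u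
      rcases pathHamiltonian_apply_eq_zero_or x a a' c c' with h | ⟨i, -, rfl, h⟩
      · exact absurd h hu
      · rcases h with ⟨rfl, rfl⟩ | ⟨rfl, rfl⟩
        · left; simp [below]
        · right; simp [above]
    refine (Set.ncard_le_ncard hsub (Set.toFinite _)).trans ?_
    exact (Set.ncard_insert_le _ _).trans (by simp)
  refine ⟨row, fun u => ?_⟩
  have : {v | pathHamiltonian x v u ≠ 0} = {v | pathHamiltonian x u v ≠ 0} := by
    ext v
    have h := (isHermitian_pathHamiltonian x).apply v u
    simp only [Set.mem_ofPred_eq, ← h, ne_eq, star_eq_zero]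
  rw [this]
  exact row u

/-- The row of `|a, c⟩` is determined by the two bits next to `a`. -/
theorem pathHamiltonian_row_congr {N : ℕ} {x y : Fin N → Fin 2} {a : Fin (N + 1)} (c : Fin 2)
    (h : ∀ i : Fin N, a = i.succ ∨ a = i.castSucc → x i = y i) :
    pathHamiltonian x (vertex a c) = pathHamiltonian y (vertex a c) := by
  ext u
  obtain ⟨a', c', rfl⟩ := exists_eq_vertex u
  rw [pathHamiltonian_apply, pathHamiltonian_apply]
  refine Finset.sum_congr rfl fun i _ => ?_
  by_cases hi : a = i.succ ∨ a = i.castSucc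
  · rw [h i hi]
  · push Not at hi
    simp [hi.1, hi.2]

/-! ### Amplitudes of a query algorithm as polynomials in the bits -/

theorem sparseEntry_congr {D d : ℕ} {H H' : Matrix (Fin D) (Fin D) ℂ} {v : Fin D}
    (h : H v = H' v) (k : Fin d) : sparseEntry H v k = sparseEntry H' v k := by
  unfold sparseEntry
  rw [h]

/-- On the basis state `q` the black box reads only the row named in the query register of `q`. -/
theorem queryGate_congr {D d b w : ℕ} (enc : Option (Fin D × ℂ) → Fin b → Bool)
    {H H' : Matrix (Fin D) (Fin D) ℂ} (p q : Registers D d b w) (h : H q.2.1.1 = H' q.2.1.1) :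
    queryGate enc H w p q = queryGate enc H' w p q := by
  have hq : queryMap enc H q.2.1 = queryMap enc H' q.2.1 := by
    simp only [queryMap, sparseEntry_congr h]
  simp only [queryGate, Matrix.of_apply]
  rw [hq]

/-- The row read by the query involves only the bits on the edges next to its position. The encoding
may be arbitrary, because only the dependence on bits is counted. -/
theorem queryGate_mem_lowDegree {N d b w : ℕ}
    (enc : Option (Fin ((N + 1) * 2) × ℂ) → Fin b → Bool)
    (p q : Registers ((N + 1) * 2) d b w) :
    (fun x : Fin N → Fin 2 => queryGate enc (pathHamiltonian x) w p q) ∈ lowDegree N 2 := by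
  obtain ⟨a, c, hv⟩ := exists_eq_vertex q.2.1.1
  refine mem_lowDegree_of_dependsOn
    (S := Finset.univ.filter fun i : Fin N => a = i.succ ∨ a = i.castSucc) ?_ ?_
  · rw [Finset.filter_or]
    refine (Finset.card_union_le _ _).trans
      (add_le_add (Finset.card_le_one.2 ?_) (Finset.card_le_one.2 ?_) : _ ≤ 1 + 1)
    · intro i hi j hj
      simp only [Finset.mem_filter, Finset.mem_univ, true_and] at hi hj
      exact Fin.succ_injective _ (hi.symm.trans hj)
    · intro i hi j hj
      simp only [Finset.mem_filter, Finset.mem_univ, true_and] at hi hj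
      exact Fin.castSucc_injective _ (hi.symm.trans hj)
  · intro x y hxy
    refine queryGate_congr enc p q ?_
    rw [hv]
    exact pathHamiltonian_row_congr c fun i hi => hxy i (by simpa using hi)

theorem sum_mem_lowDegree {N k : ℕ} {ι : Type*} (s : Finset ι)
    {f : ι → (Fin N → Fin 2) → ℂ} (hf : ∀ i ∈ s, f i ∈ lowDegree N k) :
    (fun x => ∑ i ∈ s, f i x) ∈ lowDegree N k := by
  have h := Submodule.sum_mem _ hf
  convert h using 1
  ext x
  simp

/-- A query multiplies amplitudes by functions of two bits. -/
theorem partialCircuit_mem_lowDegree {N d b : ℕ}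
    (enc : Option (Fin ((N + 1) * 2) × ℂ) → Fin b → Bool)
    (A : QueryAlgorithm ((N + 1) * 2) d b) (k : ℕ) (p q : Registers ((N + 1) * 2) d b A.work) :
    (fun x : Fin N → Fin 2 => A.partialCircuit enc (pathHamiltonian x) k p q)
      ∈ lowDegree N (2 * k) := by
  induction k generalizing p with
  | zero => exact const_mem_lowDegree N _ _
  | succ k ih =>
    simp only [QueryAlgorithm.partialCircuit, Matrix.mul_assoc]
    simp only [Matrix.mul_apply]
    refine sum_mem_lowDegree _ fun r _ => ?_
    -- Degree `0` for the fixed gate, `2` for the query, `2 * k` for the earlier circuit.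
    rw [show 2 * (k + 1) = 0 + (2 + 2 * k) by ring]
    exact mul_mem_lowDegree (const_mem_lowDegree N 0 _) (sum_mem_lowDegree _ fun s _ =>
      mul_mem_lowDegree (queryGate_mem_lowDegree enc r s) (ih s))

/-- The probability that the system register of an unnormalized state is found in `v`. -/
def systemProb {X Y : Type} [Fintype Y] (f : X × Y → ℂ) (v : X) : ℝ :=
  ∑ y, ‖f (v, y)‖ ^ 2

/-- A probability is a sum of products of an amplitude with its conjugate, which doubles the degree.
-/
theorem systemProb_mem_lowDegree {N d b : ℕ}
    (enc : Option (Fin ((N + 1) * 2) × ℂ) → Fin b → Bool)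
    (A : QueryAlgorithm ((N + 1) * 2) d b) (ψ : Registers ((N + 1) * 2) d b A.work → ℂ)
    (v : Fin ((N + 1) * 2)) :
    (fun x : Fin N → Fin 2 =>
      (systemProb (A.circuit enc (pathHamiltonian x) *ᵥ ψ) v : ℂ))
      ∈ lowDegree N (4 * A.queries) := by
  simp only [systemProb, Complex.ofReal_sum]
  refine sum_mem_lowDegree _ fun y _ => ?_
  have h : (fun x : Fin N → Fin 2 => (A.circuit enc (pathHamiltonian x) *ᵥ ψ) (v, y))
      ∈ lowDegree N (2 * A.queries) := by
    simp only [Matrix.mulVec, dotProduct]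
    exact sum_mem_lowDegree _ fun q _ =>
      mul_mem_lowDegree (l := 0) (partialCircuit_mem_lowDegree enc A _ _ q)
        (const_mem_lowDegree N 0 _)
  have h2 := mul_mem_lowDegree h (star_mem_lowDegree h)
  rw [show 2 * A.queries + 2 * A.queries = 4 * A.queries by ring] at h2
  convert h2 using 2 with x
  rw [← starRingEnd_apply, Complex.mul_conj, Complex.normSq_eq_norm_sq]

theorem sqrt_systemProb {X Y : Type} [Fintype Y] (f : X × Y → ℂ) (v : X) :
    Real.sqrt (systemProb f v) = stateNorm fun y => f (v, y) := by
  rw [systemProb, stateNorm, EuclideanSpace.norm_eq]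

theorem stateNorm_fiber_le {X Y : Type} [Fintype X] [Fintype Y] (f : X × Y → ℂ) (v : X) :
    (stateNorm fun y => f (v, y)) ≤ stateNorm f := by
  rw [stateNorm, stateNorm, EuclideanSpace.norm_eq, EuclideanSpace.norm_eq]
  refine Real.sqrt_le_sqrt ?_
  simp only [Fintype.sum_prod_type]
  exact Finset.single_le_sum (f := fun a => ∑ y, ‖f (a, y)‖ ^ 2)
    (fun a _ => by positivity) (Finset.mem_univ v)

/-- Up to the error of the simulation, the system is found in `v` with the right amplitude. -/
theorem abs_sqrt_systemProb_sub_le {X Y : Type} [Fintype X] [Fintype Y] (f : X × Y → ℂ)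
    (χ : X → ℂ) {φ : Y → ℂ} (hφ : stateNorm φ = 1) {ε : ℝ}
    (h : stateNorm (f - tensor χ φ) ≤ ε) (v : X) :
    |Real.sqrt (systemProb f v) - ‖χ v‖| ≤ ε := by
  have h1 := (stateNorm_fiber_le (f - tensor χ φ) v).trans h
  have h2 : (stateNorm fun y => tensor χ φ (v, y)) = ‖χ v‖ := by
    have : (WithLp.toLp 2 fun y => tensor χ φ (v, y) : EuclideanSpace ℂ Y)
        = χ v • WithLp.toLp 2 φ := by
      ext y; simp [tensor]
    rw [stateNorm] at hφ ⊢
    rw [this, norm_smul, hφ, mul_one]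
  rw [sqrt_systemProb, ← h2]
  refine (abs_norm_sub_norm_le _ _).trans ?_
  rw [← WithLp.toLp_sub]
  exact h1

/-- If the system moves from `|0, 0⟩` to `|N, parity x⟩` with amplitude more than twice the error,
and not to `|N, 1 + parity x⟩`, then a simulation has to query a constant fraction of the bits. -/
theorem le_four_mul_queries {N d b : ℕ}
    (enc : Option (Fin ((N + 1) * 2) × ℂ) → Fin b → Bool)
    (A : QueryAlgorithm ((N + 1) * 2) d b) {t ε : ℝ}
    (hA : ∀ x : Fin N → Fin 2, A.Simulates enc (pathHamiltonian x) t ε)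
    (hgood : ∀ x : Fin N → Fin 2, 2 * ε <
      ‖evolution (pathHamiltonian x) t (vertex (Fin.last N) (parity x)) (vertex 0 0)‖)
    (hbad : ∀ x : Fin N → Fin 2,
      evolution (pathHamiltonian x) t (vertex (Fin.last N) (1 + parity x)) (vertex 0 0) = 0) :
    N ≤ 4 * A.queries := by
  by_contra! hN
  set ψ : Fin ((N + 1) * 2) → ℂ := Pi.single (vertex 0 0) 1 with hψ
  set P : (Fin N → Fin 2) → Fin 2 → ℝ := fun x j =>
    systemProb (A.circuit enc (pathHamiltonian x) *ᵥ tensor ψ (Pi.single A.init 1))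
      (vertex (Fin.last N) j) with hP
  -- The square root of the right-hand probability exceeds `2 ε - ε`, while that of the left-hand
  -- one is at most `ε`.
  have hlt : ∀ x, P x (1 + parity x) < P x (parity x) := by
    intro x
    obtain ⟨φ, hφ, h⟩ := hA x ψ (by simp [stateNorm, hψ])
    have key := abs_sqrt_systemProb_sub_le _ _ hφ h
    have h1 := key (vertex (Fin.last N) (parity x))
    have h2 := key (vertex (Fin.last N) (1 + parity x))
    simp only [hψ, Matrix.mulVec_single_one, Matrix.col_apply] at h1 h2
    rw [hbad x, norm_zero, sub_zero] at h2
    have h3 := hgood x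
    refine (Real.sqrt_lt_sqrt_iff (Finset.sum_nonneg fun _ _ => by positivity)).1 ?_
    have h1' := (abs_le.1 h1).1
    have h2' := (abs_le.1 h2).2
    change Real.sqrt (systemProb _ _) < Real.sqrt (systemProb _ _)
    linarith
  have hmem : (fun x => (P x 0 : ℂ) - P x 1) ∈ lowDegree N (4 * A.queries) :=
    sub_mem (systemProb_mem_lowDegree enc A _ _) (systemProb_mem_lowDegree enc A _ _)
  have hsum := sum_neg_one_pow_parity_mul_eq_zero hN hmem
  -- The sign turns the difference into correct minus incorrect, so the vanishing sum would consist
  -- of positive terms.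
  have hterm : ∀ x, (-1 : ℂ) ^ (parity x : ℕ) * ((P x 0 : ℂ) - P x 1) =
      ((P x (parity x) - P x (1 + parity x) : ℝ) : ℂ) := by
    intro x
    generalize parity x = j
    fin_cases j <;> simp
  simp only [hterm, ← Complex.ofReal_sum, Complex.ofReal_eq_zero] at hsum
  refine absurd hsum (ne_of_gt ?_)
  exact Finset.sum_pos (fun x _ => sub_pos.2 (hlt x)) Finset.univ_nonempty

/-! ### Time evolution along the path -/

section Uniqueness

attribute [local instance] Matrix.linftyOpNormedRing Matrix.linftyOpNormedAlgebra

/-- The Schrödinger equation determines the evolution of its initial value. -/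
theorem evolution_mul_eq {D : ℕ} (H : Matrix (Fin D) (Fin D) ℂ)
    (Ψ : ℝ → Matrix (Fin D) (Fin D) ℂ)
    (hΨ : ∀ s, HasDerivAt Ψ ((-Complex.I) • (H * Ψ s)) s) (s : ℝ) :
    evolution H s * Ψ 0 = Ψ s := by
  have hexp : ∀ s : ℝ, HasDerivAt (fun u : ℝ => evolution H (-u))
      (evolution H (-s) * (Complex.I • H)) s := by
    intro s
    have h := hasDerivAt_exp_smul_const (𝕂 := ℝ) (Complex.I • H) s
    have e : ∀ u : ℝ, evolution H (-u) = NormedSpace.exp (u • (Complex.I • H)) := by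
      intro u
      rw [evolution, ← Complex.coe_smul u, smul_smul]
      congr 2
      push_cast
      ring
    rw [funext e, e]
    exact h
  -- The derivative of `e^{iHs} Ψ(s)` is `e^{iHs} (iH - iH) Ψ(s) = 0`.
  have hprod : ∀ s : ℝ, HasDerivAt (fun u => evolution H (-u) * Ψ u) 0 s := by
    intro s
    have h := (hexp s).mul (hΨ s)
    refine h.congr_deriv ?_
    rw [Matrix.mul_assoc, Matrix.smul_mul, ← Matrix.mul_add, neg_smul, add_neg_cancel,
      Matrix.mul_zero]
  have hconst := is_const_of_deriv_eq_zero (fun s => (hprod s).differentiableAt)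
    (fun s => (hprod s).deriv) s 0
  have h0 : evolution H 0 = 1 := by simp [evolution]
  have hinv : evolution H s * evolution H (-s) = 1 := by
    rw [evolution, evolution, ← Matrix.exp_add_of_commute _ _
      (((Commute.refl H).smul_left _).smul_right _), ← add_smul]
    simp
  simp only [neg_zero, h0, one_mul] at hconst
  rw [← hconst, ← Matrix.mul_assoc, hinv, one_mul]

end Uniqueness

/-- The parity of the first `i` bits. -/
def prefixParity {N : ℕ} (x : Fin N → Fin 2) (i : Fin (N + 1)) : Fin 2 :=
  ∑ j : Fin N, if (j : ℕ) < i then x j else 0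

theorem prefixParity_zero {N : ℕ} (x : Fin N → Fin 2) : prefixParity x 0 = 0 := by
  simp [prefixParity]

theorem prefixParity_last {N : ℕ} (x : Fin N → Fin 2) : prefixParity x (Fin.last N) = parity x := by
  simp [prefixParity, parity]

theorem prefixParity_succ {N : ℕ} (x : Fin N → Fin 2) (i : Fin N) :
    prefixParity x i.succ = prefixParity x i.castSucc + x i := by
  have h : x i = ∑ j : Fin N, if j = i then x j else 0 := by simp
  rw [h, prefixParity, prefixParity, ← Finset.sum_add_distrib]
  refine Finset.sum_congr rfl fun j _ => ?_
  simp only [Fin.val_succ, Fin.val_castSucc, Fin.ext_iff]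
  rcases lt_trichotomy (j : ℕ) i with h | h | h
  · rw [if_pos (by omega), if_pos h, if_neg (by omega), add_zero]
  · rw [if_pos (by omega), if_neg (by omega), if_pos h, zero_add]
  · rw [if_neg (by omega), if_neg (by omega), if_neg (by omega), zero_add]

/-- The amplitude of position `i` on the path at time `s`, that of a spin rotation. -/
def pathAmplitude (N i : ℕ) (s : ℝ) : ℂ :=
  Real.sqrt (N.choose i) * ((-Complex.I * Complex.sin ((s / N : ℝ) : ℂ)) ^ i *
    Complex.cos ((s / N : ℝ) : ℂ) ^ (N - i))

/-- The matrix that moves `|0, 0⟩` to position `i`. -/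
def pathMove {N : ℕ} (x : Fin N → Fin 2) (i : Fin (N + 1)) :
    Matrix (Fin ((N + 1) * 2)) (Fin ((N + 1) * 2)) ℂ :=
  Matrix.single (vertex i (prefixParity x i)) (vertex 0 0) 1

/-- The evolution of `|0, 0⟩`, written in the column of `|0, 0⟩`. -/
def pathState {N : ℕ} (x : Fin N → Fin 2) (s : ℝ) :
    Matrix (Fin ((N + 1) * 2)) (Fin ((N + 1) * 2)) ℂ :=
  ∑ i : Fin (N + 1), pathAmplitude N i s • pathMove x i

theorem single_mul_pathState {N : ℕ} (x : Fin N → Fin 2) (s : ℝ) (v : Fin ((N + 1) * 2))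
    (k : Fin (N + 1)) (c : Fin 2) :
    Matrix.single v (vertex k c) 1 * pathState x s =
      if c = prefixParity x k then
        pathAmplitude N k s • Matrix.single v (vertex 0 0) (1 : ℂ) else 0 := by
  rw [pathState, Finset.mul_sum, Finset.sum_eq_single k]
  · rw [Matrix.mul_smul, pathMove]
    split_ifs with h
    · rw [← h, Matrix.single_mul_single_same, one_mul]
    · rw [Matrix.single_mul_single_of_ne, smul_zero]
      simpa [vertex_inj] using h
  · intro i _ hi
    rw [Matrix.mul_smul, pathMove, Matrix.single_mul_single_of_ne, smul_zero]
    simp [vertex_inj, hi.symm]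
  · simp

/-- The vertices `|i, prefixParity x i⟩` are closed under adjacency: of the two parallel edges at
step `i`, one joins consecutive vertices of this path and the other misses it. -/
theorem pathHamiltonian_mul_pathState {N : ℕ} (x : Fin N → Fin 2) (s : ℝ) :
    pathHamiltonian x * pathState x s = ∑ i : Fin N,
      (((edgeWeight N i : ℂ) * pathAmplitude N i s) • pathMove x i.succ +
        ((edgeWeight N i : ℂ) * pathAmplitude N (i + 1) s) • pathMove x i.castSucc) := by
  rw [pathHamiltonian_eq_sum, Finset.sum_mul]
  refine Finset.sum_congr rfl fun i _ => ?_
  have key : ∀ p q r : Fin 2, (p + r = q ↔ p = q + r) := by decide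
  have hback : prefixParity x i.succ + x i = prefixParity x i.castSucc := by
    rw [prefixParity_succ, add_assoc, fin_two_add_self, add_zero]
  rw [Finset.sum_mul, Finset.sum_eq_single (prefixParity x i.succ)]
  · rw [Matrix.smul_mul, Matrix.add_mul, single_mul_pathState, single_mul_pathState, hback,
      if_pos rfl, if_pos rfl, smul_add, smul_smul, smul_smul]
    simp [pathMove]
  · intro j _ hj
    rw [Matrix.smul_mul, Matrix.add_mul, single_mul_pathState, single_mul_pathState, if_neg hj,
      if_neg, add_zero, smul_zero]
    rwa [key, ← prefixParity_succ]
  · simp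

/-- Squared, this is `(i + 1) C(N, i + 1) = (N - i) C(N, i)` times `i + 1`. It and its companion
below make the edge weights match the derivatives of the binomial amplitudes. -/
theorem sqrt_edge_mul_sqrt_choose {N i : ℕ} (hi : i < N) :
    Real.sqrt (((N : ℝ) - i) * (i + 1)) * Real.sqrt (N.choose i) =
      Real.sqrt (N.choose (i + 1)) * (i + 1) := by
  have h := congrArg (Nat.cast : ℕ → ℝ) (Nat.choose_succ_right_eq N i)
  push_cast [Nat.cast_sub hi.le] at h
  rw [← Real.sqrt_mul' _ (Nat.cast_nonneg _), Real.sqrt_eq_iff_mul_self_eq_of_pos]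
  · rw [mul_mul_mul_comm, Real.mul_self_sqrt (Nat.cast_nonneg _)]
    linear_combination ((i : ℝ) + 1) * h
  · have := Nat.choose_pos (Nat.succ_le_of_lt hi)
    have h' : (0 : ℝ) < N.choose (i + 1) := by exact_mod_cast this
    positivity

theorem sqrt_edge_mul_sqrt_choose_succ {N i : ℕ} (hi : i < N) :
    Real.sqrt (((N : ℝ) - i) * (i + 1)) * Real.sqrt (N.choose (i + 1)) =
      Real.sqrt (N.choose i) * (N - i) := by
  have h := congrArg (Nat.cast : ℕ → ℝ) (Nat.choose_succ_right_eq N i)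
  push_cast [Nat.cast_sub hi.le] at h
  have hlt : (0 : ℝ) < N - i := sub_pos.2 (by exact_mod_cast hi)
  rw [← Real.sqrt_mul' _ (Nat.cast_nonneg _), Real.sqrt_eq_iff_mul_self_eq_of_pos]
  · rw [mul_mul_mul_comm, Real.mul_self_sqrt (Nat.cast_nonneg _)]
    linear_combination -((N : ℝ) - i) * h
  · have h' : (0 : ℝ) < N.choose i := by exact_mod_cast Nat.choose_pos hi.le
    positivity

/-- The part of the derivative of `pathAmplitude` that flows in from below. -/
def inflowBelow (N i : ℕ) (s : ℝ) : ℂ :=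
  Real.sqrt (N.choose i) * (i * (-Complex.I * Complex.sin ((s / N : ℝ) : ℂ)) ^ (i - 1) *
    (-Complex.I * Complex.cos ((s / N : ℝ) : ℂ) / N) * Complex.cos ((s / N : ℝ) : ℂ) ^ (N - i))

/-- The part of the derivative of `pathAmplitude` that flows in from above. -/
def inflowAbove (N i : ℕ) (s : ℝ) : ℂ :=
  Real.sqrt (N.choose i) * ((-Complex.I * Complex.sin ((s / N : ℝ) : ℂ)) ^ i *
    ((N - i : ℕ) * Complex.cos ((s / N : ℝ) : ℂ) ^ (N - i - 1) *
      (-Complex.sin ((s / N : ℝ) : ℂ) / N)))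

theorem hasDerivAt_pathAmplitude (N i : ℕ) (s : ℝ) :
    HasDerivAt (pathAmplitude N i) (inflowBelow N i s + inflowAbove N i s) s := by
  have h0 : HasDerivAt (fun u : ℝ => ((u / N : ℝ) : ℂ)) (((1 / N : ℝ)) : ℂ) s :=
    ((hasDerivAt_id s).div_const (N : ℝ)).ofReal_comp
  have hsin : HasDerivAt (fun u : ℝ => -Complex.I * Complex.sin ((u / N : ℝ) : ℂ)) _ s :=
    ((Complex.hasDerivAt_sin _).comp s h0).const_mul (-Complex.I)
  have hcos : HasDerivAt (fun u : ℝ => Complex.cos ((u / N : ℝ) : ℂ)) _ s :=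
    (Complex.hasDerivAt_cos _).comp s h0
  have h := ((hsin.pow i).mul (hcos.pow (N - i))).const_mul (Real.sqrt (N.choose i) : ℂ)
  refine h.congr_deriv ?_
  simp only [inflowBelow, inflowAbove, Pi.pow_apply]
  push_cast
  ring

/-- Differentiating the sine power trades one sine for a cosine, which gives the trigonometric part
of the amplitude at `i`. -/
theorem inflowBelow_succ {N i : ℕ} (hi : i < N) (s : ℝ) :
    inflowBelow N (i + 1) s = -Complex.I * (edgeWeight N i * pathAmplitude N i s) := by
  have h := congrArg (Complex.ofReal) (sqrt_edge_mul_sqrt_choose hi)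
  rw [Complex.ofReal_mul, Complex.ofReal_mul] at h
  push_cast at h
  obtain ⟨m, rfl⟩ : ∃ m, N = i + 1 + m := ⟨N - (i + 1), by omega⟩
  rw [inflowBelow, edgeWeight, pathAmplitude]
  rw [show i + 1 + m - (i + 1) = m by omega, show i + 1 + m - i = m + 1 by omega,
    Nat.add_sub_cancel]
  push_cast at h ⊢
  simp only [pow_succ]
  linear_combination (-(-Complex.I * Complex.sin (s / (i + 1 + m))) ^ i *
    (-Complex.I * Complex.cos (s / (i + 1 + m)) / (i + 1 + m)) *
    Complex.cos (s / (i + 1 + m)) ^ m) * h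

theorem inflowAbove_eq {N i : ℕ} (hi : i < N) (s : ℝ) :
    inflowAbove N i s = -Complex.I * (edgeWeight N i * pathAmplitude N (i + 1) s) := by
  have h := congrArg (Complex.ofReal) (sqrt_edge_mul_sqrt_choose_succ hi)
  rw [Complex.ofReal_mul, Complex.ofReal_mul] at h
  push_cast at h
  obtain ⟨m, rfl⟩ : ∃ m, N = i + 1 + m := ⟨N - (i + 1), by omega⟩
  rw [inflowAbove, edgeWeight, pathAmplitude]
  rw [show i + 1 + m - (i + 1) = m by omega, show i + 1 + m - i = m + 1 by omega,
    Nat.add_sub_cancel]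
  push_cast at h ⊢
  have hI : Complex.I * Complex.I = -1 := Complex.I_mul_I
  simp only [pow_succ]
  set K : ℂ := (-Complex.I * Complex.sin (s / (i + 1 + m))) ^ i *
    (Complex.sin (s / (i + 1 + m)) / (i + 1 + m)) * Complex.cos (s / (i + 1 + m)) ^ m with hK
  -- The factor `-I` of the equation meets the one attached to the extra sine; `I * I = -1` then
  -- gives the sign of the derivative of the cosine.
  have e : -Complex.I * ((Real.sqrt (((i + 1 + m : ℝ) - i) * (i + 1)) / (i + 1 + m) : ℂ) *
      (Real.sqrt ((i + 1 + m).choose (i + 1)) *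
        ((-Complex.I * Complex.sin (s / (i + 1 + m))) ^ i *
          (-Complex.I * Complex.sin (s / (i + 1 + m))) * Complex.cos (s / (i + 1 + m)) ^ m))) =
      (Complex.I * Complex.I) * K * (Real.sqrt (((i + 1 + m : ℝ) - i) * (i + 1)) *
        Real.sqrt ((i + 1 + m).choose (i + 1))) := by
    rw [hK]; ring
  rw [e, hI, h, hK]
  ring

section

attribute [local instance] Matrix.linftyOpNormedRing Matrix.linftyOpNormedAlgebra

theorem hasDerivAt_pathState {N : ℕ} (x : Fin N → Fin 2) (s : ℝ) :
    HasDerivAt (pathState x) ((-Complex.I) • (pathHamiltonian x * pathState x s)) s := by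
  have h : HasDerivAt (fun u => ∑ i : Fin (N + 1), pathAmplitude N i u • pathMove x i)
      (∑ i : Fin (N + 1), (inflowBelow N i s + inflowAbove N i s) • pathMove x i) s :=
    HasDerivAt.fun_sum fun i _ => (hasDerivAt_pathAmplitude N i s).smul_const (pathMove x i)
  refine h.congr_deriv ?_
  -- Nothing flows in past the ends: the factors `i` and `N - i` vanish there, so the truncated
  -- exponents are harmless.
  have hbelow : inflowBelow N 0 s = 0 := by simp [inflowBelow]
  have habove : inflowAbove N N s = 0 := by simp [inflowAbove]
  simp only [add_smul, Finset.sum_add_distrib]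
  rw [Fin.sum_univ_succ, Fin.sum_univ_castSucc (n := N) (f := fun i => inflowAbove N i s • _),
    pathHamiltonian_mul_pathState]
  simp only [Fin.val_zero, hbelow, Fin.val_last, habove, zero_smul, zero_add, add_zero,
    Fin.val_succ, Fin.val_castSucc, Finset.sum_add_distrib, smul_add, Finset.smul_sum, smul_smul]
  congr 1 <;> refine Finset.sum_congr rfl fun i _ => ?_
  · rw [inflowBelow_succ i.isLt]
  · rw [inflowAbove_eq i.isLt]

theorem evolution_mul_single {N : ℕ} (x : Fin N → Fin 2) (s : ℝ) :
    evolution (pathHamiltonian x) s * Matrix.single (vertex 0 0) (vertex 0 0) 1 =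
      pathState x s := by
  rw [← evolution_mul_eq _ _ (hasDerivAt_pathState x) s]
  congr 1
  -- At time `0` the sine vanishes and only position `0` survives.
  rw [pathState, Fin.sum_univ_succ]
  simp [pathAmplitude, pathMove, prefixParity_zero]

end

theorem evolution_pathHamiltonian_apply {N : ℕ} (x : Fin N → Fin 2) (s : ℝ) (k : Fin (N + 1))
    (c : Fin 2) :
    evolution (pathHamiltonian x) s (vertex k c) (vertex 0 0) =
      if c = prefixParity x k then pathAmplitude N k s else 0 := by
  have h := congrFun (congrFun (evolution_mul_single x s) (vertex k c)) (vertex 0 0)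
  rw [Matrix.mul_single_apply_same, mul_one] at h
  rw [h, pathState, Matrix.sum_apply, Finset.sum_eq_single k]
  · simp [pathMove, Matrix.single_apply, vertex_inj, eq_comm]
  · intro i _ hi
    simp [pathMove, vertex_inj, hi]
  · simp

theorem norm_evolution_pathHamiltonian_last {N : ℕ} (x : Fin N → Fin 2) (s : ℝ) :
    ‖evolution (pathHamiltonian x) s (vertex (Fin.last N) (parity x)) (vertex 0 0)‖ =
      |Real.sin (s / N)| ^ N := by
  rw [evolution_pathHamiltonian_apply, prefixParity_last, if_pos rfl, pathAmplitude,
    ← Complex.ofReal_sin]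
  simp [-Complex.ofReal_sin]

theorem evolution_pathHamiltonian_last_eq_zero {N : ℕ} (x : Fin N → Fin 2) (s : ℝ) :
    evolution (pathHamiltonian x) s (vertex (Fin.last N) (1 + parity x)) (vertex 0 0) = 0 := by
  rw [evolution_pathHamiltonian_apply, prefixParity_last, if_neg]
  simp

/-! ### The length of the path -/

open Filter in
-- With `L = log (1 / ε)`, the bounds in turn make the path longer than `t`, absorb the factor `2 /
-- t`, absorb the factor `2` of `2 ε`, and keep `log L` away from `0`.
theorem eventually_log_bounds (t : ℝ) : ∀ᶠ L : ℝ in atTop,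
    (12 + 4 * t) * (2 * Real.log L) ≤ L ∧ 2 * Real.log (2 / t) ≤ Real.log L ∧
      4 * Real.log 2 < L ∧ 1 < Real.log L := by
  have h1 : ∀ᶠ L : ℝ in atTop, (12 + 4 * t) * (2 * Real.log L) ≤ L := by
    have h := (Real.isLittleO_log_id_atTop.const_mul_left ((12 + 4 * t) * 2)).bound
      (c := 1) one_pos
    filter_upwards [h, eventually_ge_atTop 0] with L hL h0
    simp only [id, one_mul, Real.norm_eq_abs, abs_of_nonneg h0] at hL
    linarith [le_abs_self ((12 + 4 * t) * 2 * Real.log L)]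
  filter_upwards [h1, Real.tendsto_log_atTop.eventually_ge_atTop (2 * Real.log (2 / t)),
    eventually_gt_atTop (4 * Real.log 2), Real.tendsto_log_atTop.eventually_gt_atTop 1]
    with L a b c d using ⟨a, b, c, d⟩

/-- A path of length of order `log (1 / ε) / log log (1 / ε)` along which the amplitude that is
transported in time `t` exceeds `2 ε`. -/
theorem exists_path_length {t : ℝ} (ht : 0 < t) : ∃ ε₀ : ℝ, 0 < ε₀ ∧ ∀ ε : ℝ, 0 < ε → ε < ε₀ →
    ∃ N n : ℕ, 2 ≤ N ∧ N + 1 = 2 ^ n ∧ 2 * ε < |Real.sin (t / N)| ^ N ∧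
      1 / 32 * (Real.log (1 / ε) / Real.log (Real.log (1 / ε))) ≤ (N : ℝ) / 4 := by
  obtain ⟨L₀, hL₀⟩ := Filter.eventually_atTop.1 (eventually_log_bounds t)
  refine ⟨Real.exp (-L₀), Real.exp_pos _, fun ε hε hlt => ?_⟩
  have hLge : L₀ ≤ Real.log (1 / ε) := by
    rw [one_div, Real.log_inv]
    have := (Real.log_lt_iff_lt_exp hε).2 hlt
    linarith
  obtain ⟨ha, hb, hc, hd⟩ := hL₀ _ hLge
  have hlogε : Real.log ε = -Real.log (1 / ε) := by rw [one_div, Real.log_inv, neg_neg]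
  generalize Real.log (1 / ε) = L at *
  -- Chosen so that for `N ≤ M` the loss `N * (3 / 2 * log L)` is at most `3 / 4 * L`; the remaining
  -- `L / 4` exceeds `log 2`.
  set M : ℝ := L / (2 * Real.log L) with hM
  have hMl : 12 + 4 * t ≤ M := (le_div_iff₀ (by linarith)).2 ha
  have hML : M * (2 * Real.log L) = L := div_mul_cancel₀ _ (by linarith)
  obtain ⟨n, hn1, hn2⟩ := exists_nat_pow_near (x := M) (y := 2) (by linarith) (by norm_num)
  obtain ⟨N, hN⟩ : ∃ N : ℕ, N + 1 = 2 ^ n :=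
    ⟨2 ^ n - 1, Nat.sub_add_cancel Nat.one_le_two_pow⟩
  have hNr : (N : ℝ) + 1 = 2 ^ n := by exact_mod_cast hN
  -- Rounding down to a power of two costs a factor `2`, and subtracting one is absorbed by a
  -- further factor `2`, as `M ≥ 12`.
  have hNM : M / 4 ≤ N := by rw [pow_succ] at hn2; linarith
  have hN3 : 3 + t ≤ N := by linarith
  have hNpos : (0 : ℝ) < N := by linarith
  refine ⟨N, n, ?_, hN, ?_, ?_⟩
  · have : (2 : ℝ) ≤ N := by linarith
    exact_mod_cast this
  · have hle1 : t / N ≤ 1 := (div_le_one hNpos).2 (by linarith)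
    have hpos : 0 < t / (2 * N) := by positivity
    -- Jordan's inequality `2 / π * u ≤ sin u`, with `2 / π ≥ 1 / 2`.
    have hsin : t / (2 * N) ≤ |Real.sin (t / N)| := by
      refine le_trans ?_ ((Real.mul_le_sin (by positivity)
        (by linarith [Real.pi_gt_three])).trans (le_abs_self _))
      have : (1 : ℝ) / 2 ≤ 2 / Real.pi := by
        rw [div_le_div_iff₀ (by norm_num) Real.pi_pos]
        linarith [Real.pi_le_four]
      calc t / (2 * N) = 1 / 2 * (t / N) := by field_simp
        _ ≤ _ := by gcongr
    refine lt_of_lt_of_le ?_ (pow_le_pow_left₀ hpos.le hsin N)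
    rw [← Real.log_lt_log_iff (by positivity) (by positivity), Real.log_pow,
      Real.log_mul (by norm_num) hε.ne', hlogε]
    have hlog : Real.log (t / (2 * N)) = -(Real.log (2 / t) + Real.log N) := by
      rw [← Real.log_mul (by positivity) hNpos.ne', ← Real.log_inv]
      congr 1
      field_simp
    have hNleL : Real.log N ≤ Real.log L := Real.log_le_log hNpos (by nlinarith)
    have h1 : (N : ℝ) * (Real.log (2 / t) + Real.log N) ≤ N * (3 / 2 * Real.log L) := by
      gcongr
      linarith
    have h2 : (N : ℝ) * (3 / 2 * Real.log L) ≤ M * (3 / 2 * Real.log L) := by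
      gcongr
      linarith
    rw [hlog]
    linarith
  -- The constant is `1 / 32` because `N / 4 ≥ M / 16 = (2 * M) / 32`.
  · have : L / Real.log L = 2 * M := by rw [hM]; field_simp
    rw [this]
    linarith

end HamSim

end

theorem theorem2 :
    ∃ c : ℝ, 0 < c ∧ ∀ t : ℝ, 0 < t → ∃ ε₀ : ℝ, 0 < ε₀ ∧ ∀ ε : ℝ, 0 < ε → ε < ε₀ →
      ∃ N n : ℕ, 2 ≤ N ∧ N + 1 = 2 ^ n ∧
        (∀ x : Fin N → Fin 2,
          (HamSim.pathHamiltonian x).IsHermitian ∧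
          HamSim.IsSparse 2 (HamSim.pathHamiltonian x) ∧
          HamSim.maxNorm (HamSim.pathHamiltonian x) < 1 ∧
          ∀ s : ℝ,
            ‖HamSim.evolution (HamSim.pathHamiltonian x) s
                (HamSim.vertex (Fin.last N) (HamSim.parity x)) (HamSim.vertex 0 0)‖
              = |Real.sin (s / N)| ^ N ∧
            HamSim.evolution (HamSim.pathHamiltonian x) s
                (HamSim.vertex (Fin.last N) (1 + HamSim.parity x)) (HamSim.vertex 0 0) = 0) ∧
        ∀ (b : ℕ) (enc : Option (Fin ((N + 1) * 2) × ℂ) → Fin b → Bool)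
          (A : HamSim.QueryAlgorithm ((N + 1) * 2) 2 b),
          (∀ x : Fin N → Fin 2, A.Simulates enc (HamSim.pathHamiltonian x) t ε) →
            c * (Real.log (1 / ε) / Real.log (Real.log (1 / ε))) ≤ (A.queries : ℝ) := by
  refine ⟨1 / 32, by norm_num, fun t ht => ?_⟩
  obtain ⟨ε₀, hε₀, h⟩ := HamSim.exists_path_length ht
  refine ⟨ε₀, hε₀, fun ε hε hlt => ?_⟩
  obtain ⟨N, n, hN, hNn, hsin, hle⟩ := h ε hε hlt
  refine ⟨N, n, hN, hNn, fun x => ⟨HamSim.isHermitian_pathHamiltonian x,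
    HamSim.isSparse_pathHamiltonian x, HamSim.maxNorm_pathHamiltonian_lt_one hN x,
    fun s => ⟨HamSim.norm_evolution_pathHamiltonian_last x s,
      HamSim.evolution_pathHamiltonian_last_eq_zero x s⟩⟩, fun b enc A hA => ?_⟩
  have hq := HamSim.le_four_mul_queries enc A hA
    (fun x => by rwa [HamSim.norm_evolution_pathHamiltonian_last])
    (fun x => HamSim.evolution_pathHamiltonian_last_eq_zero x t)
  have hq' : (N : ℝ) ≤ 4 * A.queries := by exact_mod_cast hq
  linarith
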